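/- Let $G=(V,E)$ be a finite tree, and choose an orientation of each of its edges. Let $\mathcal A_G$ be the automaton with alphabet $V$ whose states are the oriented edges of $G$ together with a state $\mathrm{id}$. A state acts on words over $V$ as follows: $\mathrm{id}$ fixes every word, and for $e=(x,y)$ and a word $zw$ with first letter $z$, $$e(xw)=y\,e(w),\qquad e(yw)=xw,\qquad e(zw)=zw\quad (z\neq x,y),$$ and $e$ fixes the empty word. For $n\ge 0$ let $\Gamma_n^G$ be the $n$-th Schreier graph of $\mathcal A_G$, i.e. the undirected multigraph (with loops and parallel edges) with vertex set $V^n$ and with one edge $\{u,q(u)\}$ for every state $q$ and every $u\in V^n$. For a finite connected multigraph $\Gamma$ with distance $d$ let $$W(\Gamma)=\tfrac12\sum_{u,v\in V(\Gamma)} d(u,v),\qquad \mathrm{Sz}(\Gamma)=\sum_{e=\{u,v\}\in E(\Gamma)} n(u,v)\,n(v,u)$$ be its Wiener index (the sum of the distances over all unordered pairs of vertices) and its Szeged index, where $n(u,v)$ is the number of vertices of $\Gamma$ strictly closer to $u$ than to $v$, and parallel edges are counted with multiplicity. Then for every finite tree $G$, every choice of orientation of its edges and every $n\ge 0$, the graph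 $\Gamma_n^G$ is connected and $$\mathrm{Sz}(\Gamma_n^G)=2\,W(\Gamma_n^G).$$ -/

import Mathlib

/-! ### Finite multigraphs, Wiener index and Szeged index -/

/-- An undirected multigraph (loops and parallel edges allowed) with vertex set `V` and
edge set `E`: every edge has an unordered pair of end vertices. -/
structure Multigraph (V E : Type*) where
  /-- The unordered pair of end vertices of an edge. -/
  ends : E → Sym2 V

namespace Multigraph

variable {V E : Type*}

/-- The underlying simple graph: distinct vertices are adjacent if some edge joins them.
Dropping loops and identifying parallel edges does not change distances or connectedness. -/
def simplify (Γ : Multigraph V E) : SimpleGraph V where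
  Adj u v := u ≠ v ∧ ∃ e, Γ.ends e = s(u, v)
  symm := ⟨fun _ _ h => ⟨h.1.symm, h.2.imp fun _ he => he.trans Sym2.eq_swap⟩⟩
  loopless := ⟨fun _ h => h.1 rfl⟩

/-- A multigraph is connected if it has a vertex and any two vertices are joined by a path. -/
def Connected (Γ : Multigraph V E) : Prop := Γ.simplify.Connected

/-- The distance of two vertices: the length of a shortest path joining them. -/
noncomputable def dist (Γ : Multigraph V E) (u v : V) : ℕ := Γ.simplify.dist u v

/-- The total distance from `v`: the sum of the distances of all vertices from `v`. -/
noncomputable def totalDist [Fintype V] (Γ : Multigraph V E) (v : V) : ℕ := ∑ u, Γ.dist u v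

/-- The Wiener index: the sum of the distances of all unordered pairs of vertices, i.e. half the
sum of all total distances. -/
noncomputable def wiener [Fintype V] (Γ : Multigraph V E) : ℚ :=
  (1 / 2) * ∑ v, (Γ.totalDist v : ℚ)

/-- `n(u, v)`: the number of vertices strictly closer to `u` than to `v`. -/
noncomputable def numCloser [Fintype V] (Γ : Multigraph V E) (u v : V) : ℕ :=
  (Finset.univ.filter fun w => Γ.dist w u < Γ.dist w v).card

/-- The Szeged index: the sum of `n(u, v) * n(v, u)` over all edges `e` with ends `u`, `v`, where
parallel edges are counted with multiplicity (and loops contribute `0`). -/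
noncomputable def szeged [Fintype V] [Fintype E] (Γ : Multigraph V E) : ℕ :=
  ∑ e, Sym2.lift ⟨fun u v => Γ.numCloser u v * Γ.numCloser v u, fun _ _ => Nat.mul_comm _ _⟩
    (Γ.ends e)

end Multigraph

/-! ### Automata and their Schreier graphs -/

/-- An automaton (transducer) with set of states `Q` and alphabet `X`. -/
structure Transducer (Q X : Type*) where
  /-- The restriction map `λ`. -/
  restr : Q → X → Q
  /-- The output map `η`. -/
  out : Q → X → X

namespace Transducer

variable {Q X : Type*}

/-- The action of a state on words of length `n`:
`η(q, x w) = η(q, x) η(λ(q, x), w)` for a letter `x` and a word `w`. -/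
def act (A : Transducer Q X) : {n : ℕ} → Q → (Fin n → X) → (Fin n → X)
  | 0, _, w => w
  | _ + 1, q, w => Fin.cons (A.out q (w 0)) (A.act (A.restr q (w 0)) (Fin.tail w))

/-- The `n`-th Schreier graph: its vertices are the words of length `n`, and every state `q` and
word `u` give one edge (labelled `q`), which joins `u` and `η(q, u)`. -/
def schreierGraph (A : Transducer Q X) (n : ℕ) : Multigraph (Fin n → X) (Q × (Fin n → X)) where
  ends e := s(e.2, A.act e.1 e.2)

end Transducer

/-! ### The automaton of an oriented graph -/

/-- A choice of an orientation `(source e, target e)` of every edge `e` of `G`. -/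
structure SimpleGraph.EdgeOrientation {V : Type*} (G : SimpleGraph V) where
  /-- The first vertex of the oriented edge. -/
  source : G.edgeSet → V
  /-- The second vertex of the oriented edge. -/
  target : G.edgeSet → V
  ends_eq : ∀ e : G.edgeSet, s(source e, target e) = (e : Sym2 V)

/-- The graph automaton `A_G`: the alphabet is the vertex set of `G`, the states are the (oriented)
edges `some e` of `G` and the sink `none = id`. The state `e = (x, y)` exchanges the letters `x`
and `y`, fixes all other letters, has restriction `e` at `x` and restriction `id` elsewhere. -/
def SimpleGraph.EdgeOrientation.automaton {V : Type*} [DecidableEq V] {G : SimpleGraph V}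
    (o : G.EdgeOrientation) : Transducer (Option G.edgeSet) V where
  restr
    | none, _ => none
    | some e, z => if z = o.source e then some e else none
  out
    | none, z => z
    | some e, z => if z = o.source e then o.target e else if z = o.target e then o.source e else z

/-! Each Schreier graph is a cactus: its blocks are orbits of states, cycles of even length or
loops, and every vertex has a well-defined gate in every orbit. In an orbit of length `2m`, deleting
an arrow and the arrow `m` steps further splits the graph into two sides. The distance of `a` and
`b` is the number of such opposite pairs separating them; equivalently, the number of single arrows
with `b` beyond and `a` not beyond, since exactly one arrow of a separating pair qualifies
(`dist_eq_cutDist`). The vertices closer to the head of an arrow are those beyond it, so its Szeged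
term counts the ordered pairs `(a, b)` that it separates in this direction
(`numCloser_mul_numCloser`). Summing over all arrows gives the sum of distances over ordered pairs,
which is twice the Wiener index (`szeged_eq_sum_totalDist`). The automaton of a tree has such gates
(`isGateSystem`): on words over its two ends a state `e` is an adding machine, so prefixing an end
of `e` doubles an orbit, and gates are built letter by letter from the two sides into which deleting
`e` cuts the tree. -/

open Equiv.Perm Function

/-! ### Gates and opposite arrows in even orbits. -/

/-- A family of permutations `σ e` of `X` together with a projection (gate) `g e u a` of every
point `a` to the `σ e`-orbit of every point `u`, such that the projection to an orbit changes only
along the arrows of that orbit, and such that the nontrivial orbits are of even size. The Schreier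
graphs of such families are the cactus graphs with even cycles. -/
structure IsGateSystem {X E : Type*} (σ : E → Equiv.Perm X) (g : E → X → X → X) : Prop where
  gate_apply : ∀ e u a, g e (σ e u) a = g e u a
  sameCycle : ∀ e u a, (σ e).SameCycle u (g e u a)
  gate_self : ∀ e u, g e u u = u
  gate_move : ∀ e f u b, ¬(e = f ∧ (σ e).SameCycle u b) → g e u (σ f b) = g e u b
  even_period : ∀ e u, σ e u ≠ u → Even (minimalPeriod (σ e) u)

namespace IsGateSystem

variable {X E : Type*} {σ : E → Equiv.Perm X} {g : E → X → X → X}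

/-- Half of the size of the `σ e`-orbit of `u`, rounded down. -/
noncomputable def halfPeriod (σ : E → Equiv.Perm X) (e : E) (u : X) : ℕ :=
  minimalPeriod (σ e) u / 2

/-- `a` lies beyond the arrow from `u` to `σ e u`: its gate is one of the `halfPeriod` points that
follow `u` in its `σ e`-orbit. -/
def Beyond (σ : E → Equiv.Perm X) (g : E → X → X → X) (e : E) (u a : X) : Prop :=
  ∃ j, 1 ≤ j ∧ j ≤ halfPeriod σ e u ∧ g e u a = (σ e)^[j] u

theorem minimalPeriod_pos [Finite X] (σ : E → Equiv.Perm X) (e : E) (u : X) :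
    0 < minimalPeriod (σ e) u :=
  minimalPeriod_pos_of_mem_periodicPts ((σ e).injective.mem_periodicPts u)

theorem two_mul_halfPeriod (h : IsGateSystem σ g) {e : E} {u : X} (hu : σ e u ≠ u) :
    2 * halfPeriod σ e u = minimalPeriod (σ e) u :=
  Nat.two_mul_div_two_of_even (h.even_period e u hu)

/-- The rounding matters for loops: period 1 gives 0, so nothing lies beyond a loop. -/
theorem halfPeriod_eq_zero {e : E} {u : X} (hu : σ e u = u) : halfPeriod σ e u = 0 := by
  have : minimalPeriod (σ e) u = 1 := minimalPeriod_eq_one_iff_isFixedPt.2 hu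
  simp [halfPeriod, this]

theorem minimalPeriod_iterate [Finite X] (σ : E → Equiv.Perm X) (e : E) (u : X) (i : ℕ) :
    minimalPeriod (σ e) ((σ e)^[i] u) = minimalPeriod (σ e) u :=
  minimalPeriod_apply_iterate ((σ e).injective.mem_periodicPts u) i

theorem iterate_ne_self {e : E} {u : X} (hu : σ e u ≠ u) (i : ℕ) :
    σ e ((σ e)^[i] u) ≠ (σ e)^[i] u := by
  rw [← iterate_succ_apply' (σ e), iterate_succ_apply]
  exact fun hi => hu ((σ e).injective.iterate i hi)

theorem exists_iterate_eq [Finite X] {e : E} {u v : X} (huv : (σ e).SameCycle u v) :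
    ∃ j < minimalPeriod (σ e) u, (σ e)^[j] u = v := by
  obtain ⟨i, hi⟩ := huv.exists_nat_pow_eq
  refine ⟨i % minimalPeriod (σ e) u, Nat.mod_lt _ (minimalPeriod_pos σ e u), ?_⟩
  rw [iterate_mod_minimalPeriod_eq, Equiv.Perm.iterate_eq_pow, hi]

theorem sameCycle_iterate (e : E) (u : X) (i : ℕ) : (σ e).SameCycle u ((σ e)^[i] u) :=
  ⟨i, by rw [Equiv.Perm.iterate_eq_pow, zpow_natCast]⟩

theorem gate_iterate (h : IsGateSystem σ g) (e : E) (u a : X) (i : ℕ) :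
    g e ((σ e)^[i] u) a = g e u a := by
  induction i with
  | zero => rfl
  | succ i ih => rw [iterate_succ_apply', h.gate_apply, ih]

theorem gate_eq_of_sameCycle [Finite X] (h : IsGateSystem σ g) {e : E} {u v : X}
    (huv : (σ e).SameCycle u v) (a : X) : g e u a = g e v a := by
  obtain ⟨j, -, rfl⟩ := exists_iterate_eq huv
  rw [h.gate_iterate]

theorem gate_of_sameCycle [Finite X] (h : IsGateSystem σ g) {e : E} {u v : X}
    (huv : (σ e).SameCycle u v) : g e u v = v := by
  rw [h.gate_eq_of_sameCycle huv, h.gate_self]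

theorem beyond_iff (h : IsGateSystem σ g) {e : E} {u a : X} (hu : σ e u ≠ u) {j : ℕ}
    (hj : j < minimalPeriod (σ e) u) (ha : g e u a = (σ e)^[j] u) :
    Beyond σ g e u a ↔ 1 ≤ j ∧ j ≤ halfPeriod σ e u := by
  refine ⟨?_, fun hj' => ⟨j, hj'.1, hj'.2, ha⟩⟩
  rintro ⟨i, hi, him, hia⟩
  have hT := h.two_mul_halfPeriod hu
  have : i = j := (iterate_eq_iterate_iff_of_lt_minimalPeriod (by omega) hj).1 (hia.symm.trans ha)
  omega

theorem not_beyond_of_fixed {e : E} {u a : X} (hu : σ e u = u) : ¬Beyond σ g e u a := by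
  rintro ⟨j, h1, h2, -⟩
  rw [halfPeriod_eq_zero hu] at h2
  omega

/-- The start of the arrow opposite to the arrow from `u` in its `σ e`-orbit. -/
noncomputable def antipode (σ : E → Equiv.Perm X) (e : E) (u : X) : X :=
  (σ e)^[halfPeriod σ e u] u

/-- Seen from the antipode, the position of the gate shifts by `m` modulo `2m`, which exchanges the
positions `1, ..., m` with the remaining ones. -/
theorem beyond_antipode [Finite X] (h : IsGateSystem σ g) {e : E} {u : X} (hu : σ e u ≠ u) (a : X) :
    Beyond σ g e (antipode σ e u) a ↔ ¬Beyond σ g e u a := by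
  obtain ⟨j, hj, hja⟩ := exists_iterate_eq (h.sameCycle e u a)
  rw [h.beyond_iff hu hj hja.symm]
  have hT := h.two_mul_halfPeriod hu
  have hmin := minimalPeriod_iterate σ e u (halfPeriod σ e u)
  have hg : g e (antipode σ e u) a = (σ e)^[j] u := by rw [antipode, h.gate_iterate, hja]
  have hhalf : halfPeriod σ e (antipode σ e u) = halfPeriod σ e u := by
    rw [halfPeriod, antipode, hmin, ← halfPeriod]
  have hu' : σ e (antipode σ e u) ≠ antipode σ e u := iterate_ne_self hu _
  rcases lt_or_ge j (halfPeriod σ e u) with hlt | hge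
  · rw [h.beyond_iff (j := j + halfPeriod σ e u) hu', hhalf]
    · omega
    · rw [antipode, hmin]; omega
    · rw [hg, antipode, ← iterate_add_apply,
        show j + halfPeriod σ e u + halfPeriod σ e u = j + minimalPeriod (σ e) u by omega,
        iterate_add_minimalPeriod_eq]
  · rw [h.beyond_iff (j := j - halfPeriod σ e u) hu', hhalf]
    · omega
    · rw [antipode, hmin]; omega
    · rw [hg, antipode, ← iterate_add_apply, Nat.sub_add_cancel hge]

/-- Crossing the arrow from `b` moves only the gate in that one orbit, by one step. The window of
`m` positions is then entered only for the arrow crossed and left only for its opposite. -/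
theorem beyond_apply_iff [Finite X] (h : IsGateSystem σ g) {f : E} {b : X} (hb : σ f b ≠ b)
    (e : E) (u : X) :
    Beyond σ g e u (σ f b) ↔
      (Beyond σ g e u b ∨ (e, u) = (f, b)) ∧ (e, u) ≠ (f, antipode σ f b) := by
  by_cases hc : e = f ∧ (σ e).SameCycle u b
  · obtain ⟨rfl, hub⟩ := hc
    obtain ⟨j, hj, rfl⟩ := exists_iterate_eq hub
    have hu : σ e u ≠ u := fun hu => hb <| by
      rw [← iterate_succ_apply' (σ e), iterate_succ_apply, hu]
    have hT := h.two_mul_halfPeriod hu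
    have hper : (σ e)^[minimalPeriod (σ e) u] u = u := iterate_minimalPeriod
    have h0 : (e, u) = (e, (σ e)^[j] u) ↔ j = 0 := by
      constructor
      · intro hu
        exact ((iterate_eq_iterate_iff_of_lt_minimalPeriod (by omega) hj).1
          (show (σ e)^[0] u = _ from (Prod.mk.inj hu).2)).symm
      · rintro rfl; rfl
    -- The antipode of `b` is the iterate `m + j` of `u`; with `0 ≤ j < 2m` it equals `u` only for
    -- `j = m`.
    have hm : (e, u) = (e, antipode σ e ((σ e)^[j] u)) ↔ j = halfPeriod σ e u := by
      rw [antipode, halfPeriod, minimalPeriod_iterate, ← halfPeriod, ← iterate_add_apply]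
      constructor
      · intro hu
        have hu := (Prod.mk.inj hu).2
        rcases lt_or_ge j (halfPeriod σ e u) with hlt | hge
        · have := (iterate_eq_iterate_iff_of_lt_minimalPeriod (by omega) (by omega)).1
            (show (σ e)^[0] u = _ from hu)
          omega
        · rw [show halfPeriod σ e u + j = j - halfPeriod σ e u + minimalPeriod (σ e) u by omega,
            iterate_add_minimalPeriod_eq] at hu
          have := (iterate_eq_iterate_iff_of_lt_minimalPeriod (by omega) (by omega)).1
            (show (σ e)^[0] u = _ from hu)
          omega
      · rintro hj
        rw [show halfPeriod σ e u + j = minimalPeriod (σ e) u by omega, hper]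
    rw [h0, ne_eq, hm, h.beyond_iff hu hj (h.gate_of_sameCycle hub), ← iterate_succ_apply' (σ e)]
    -- At the last position the step wraps around to position 0.
    rcases eq_or_lt_of_le (Nat.succ_le_of_lt hj) with heq | hlt
    · rw [heq, hper, h.beyond_iff hu (j := 0) (by omega) (h.gate_self e u)]
      omega
    · rw [h.beyond_iff hu hlt (h.gate_of_sameCycle (sameCycle_iterate e u _))]
      omega
  · have hne (v : X) (hv : (σ f).SameCycle v b) : (e, u) ≠ (f, v) := by
      rintro ⟨⟩; exact hc ⟨rfl, hv⟩
    simp only [Beyond, h.gate_move e f u b hc, hne b (SameCycle.refl _ _), ne_eq,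
      hne _ (sameCycle_iterate f b _).symm, antipode, or_false, not_false_eq_true, and_true]

theorem not_beyond_self (h : IsGateSystem σ g) (e : E) (u : X) : ¬Beyond σ g e u u := by
  by_cases hu : σ e u = u
  · exact not_beyond_of_fixed hu
  · by_cases hT : 0 < minimalPeriod (σ e) u
    · rw [h.beyond_iff hu (j := 0) hT (h.gate_self e u)]; omega
    -- An infinite orbit has `minimalPeriod` 0, so its window is empty.
    · rintro ⟨j, h1, h2, -⟩; rw [halfPeriod] at h2; omega

variable {Γ : Multigraph X (E × X)}

theorem adj_iff (hΓ : ∀ e u, Γ.ends (e, u) = s(u, σ e u)) {u v : X} :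
    Γ.simplify.Adj u v ↔ u ≠ v ∧ ∃ e, σ e u = v ∨ σ e v = u := by
  refine and_congr_right fun _ => ⟨?_, ?_⟩
  · rintro ⟨⟨e, w⟩, hw⟩
    rw [hΓ, Sym2.eq_iff] at hw
    rcases hw with ⟨rfl, rfl⟩ | ⟨rfl, rfl⟩
    · exact ⟨e, Or.inl rfl⟩
    · exact ⟨e, Or.inr rfl⟩
  · rintro ⟨e, rfl | rfl⟩
    · exact ⟨(e, u), hΓ e u⟩
    · exact ⟨(e, v), (hΓ e v).trans Sym2.eq_swap⟩

/-- A walk that avoids `b` does not meet the points whose gate in an orbit of `b` is `b`. -/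
theorem gate_ne_of_walk [Finite X] (h : IsGateSystem σ g) (hΓ : ∀ e u, Γ.ends (e, u) = s(u, σ e u))
    (f : E) (b : X) {c a : X} (p : Γ.simplify.Walk c a) (hp : b ∉ p.support)
    (hc : g f b c ≠ b) : g f b a ≠ b := by
  have key (e : E) (u : X) (hu : u ≠ b) (heu : σ e u ≠ b) : g f b (σ e u) = b ↔ g f b u = b := by
    by_cases hs : f = e ∧ (σ f).SameCycle b u
    · obtain ⟨rfl, hs⟩ := hs
      rw [h.gate_of_sameCycle hs, h.gate_of_sameCycle (sameCycle_apply_right.2 hs)]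
      exact iff_of_false heu hu
    · rw [h.gate_move f e b u hs]
  induction p with
  | nil => exact hc
  | @cons u w v huw p ih =>
    rw [SimpleGraph.Walk.support_cons, List.mem_cons, not_or] at hp
    have hw : w ≠ b := fun hw => hp.2 (hw ▸ p.start_mem_support)
    refine ih hp.2 ?_
    obtain ⟨-, e, rfl | rfl⟩ := (adj_iff hΓ).1 huw
    · rwa [ne_eq, key e u (Ne.symm hp.1) hw]
    · rwa [ne_eq, ← key e w hw (Ne.symm hp.1)]

/-! ### Distance as a number of separating arrows, and the double count. -/

section Cuts

open scoped Classical

variable [Fintype X] [Fintype E]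

/-- The arrows `(e, u)` beyond which `b` lies. -/
noncomputable def cuts (σ : E → Equiv.Perm X) (g : E → X → X → X) (b : X) : Finset (E × X) :=
  Finset.univ.filter fun p => Beyond σ g p.1 p.2 b

/-- The number of arrows beyond which `b` lies, but `a` does not. -/
noncomputable def cutDist (σ : E → Equiv.Perm X) (g : E → X → X → X) (a b : X) : ℕ :=
  (cuts σ g b \ cuts σ g a).card

theorem mem_cuts {p : E × X} {b : X} : p ∈ cuts σ g b ↔ Beyond σ g p.1 p.2 b := by
  simp [cuts]

theorem cuts_apply (h : IsGateSystem σ g) {f : E} {b : X} (hb : σ f b ≠ b) :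
    cuts σ g (σ f b) = (insert (f, b) (cuts σ g b)).erase (f, antipode σ f b) := by
  ext ⟨e, u⟩
  rw [mem_cuts, h.beyond_apply_iff hb, Finset.mem_erase, Finset.mem_insert, mem_cuts]
  tauto

/-- The cuts of `b` gain one arrow and lose the opposite one, and exactly one of these two is a cut
of `a`; which one decides the sign of the change. -/
theorem cutDist_apply (h : IsGateSystem σ g) {f : E} {b : X} (hb : σ f b ≠ b) (a : X) :
    (Beyond σ g f b a → cutDist σ g a (σ f b) + 1 = cutDist σ g a b) ∧
      (¬Beyond σ g f b a → cutDist σ g a (σ f b) = cutDist σ g a b + 1) := by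
  have hant := h.beyond_antipode hb
  have h1 : (f, b) ∉ cuts σ g b := fun hm => h.not_beyond_self f b (mem_cuts.1 hm)
  have h2 : (f, antipode σ f b) ∈ cuts σ g b := mem_cuts.2 ((hant b).2 (h.not_beyond_self f b))
  have h12 : (f, b) ≠ (f, antipode σ f b) := fun he => h1 (he ▸ h2)
  constructor <;> intro ha
  · have h1a : (f, b) ∈ cuts σ g a := mem_cuts.2 ha
    have h2a : (f, antipode σ f b) ∉ cuts σ g a := fun hm => (hant a).1 (mem_cuts.1 hm) ha
    have : cuts σ g (σ f b) \ cuts σ g a =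
        (cuts σ g b \ cuts σ g a).erase (f, antipode σ f b) := by
      rw [h.cuts_apply hb]
      ext p
      simp only [Finset.mem_sdiff, Finset.mem_erase, Finset.mem_insert]
      constructor
      · rintro ⟨⟨hp, rfl | hpb⟩, hpa⟩
        · exact absurd h1a hpa
        · exact ⟨hp, hpb, hpa⟩
      · tauto
    rw [cutDist, this, Finset.card_erase_add_one (Finset.mem_sdiff.2 ⟨h2, h2a⟩), cutDist]
  · have h1a : (f, b) ∉ cuts σ g a := fun hm => ha (mem_cuts.1 hm)
    have h2a : (f, antipode σ f b) ∈ cuts σ g a := mem_cuts.2 ((hant a).2 ha)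
    have : cuts σ g (σ f b) \ cuts σ g a = insert (f, b) (cuts σ g b \ cuts σ g a) := by
      rw [h.cuts_apply hb]
      ext p
      simp only [Finset.mem_sdiff, Finset.mem_erase, Finset.mem_insert]
      constructor
      · tauto
      · rintro (rfl | ⟨hpb, hpa⟩)
        · exact ⟨⟨h12, Or.inl rfl⟩, h1a⟩
        · exact ⟨⟨fun hp => hpa (hp ▸ h2a), Or.inr hpb⟩, hpa⟩
    rw [cutDist, this, Finset.card_insert_of_notMem fun hm => h1 (Finset.mem_sdiff.1 hm).1, cutDist]

theorem cutDist_self (a : X) : cutDist σ g a a = 0 := by simp [cutDist]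

theorem cutDist_le_of_adj (h : IsGateSystem σ g) (hΓ : ∀ e u, Γ.ends (e, u) = s(u, σ e u))
    {u v : X} (huv : Γ.simplify.Adj u v) (a : X) : cutDist σ g a v ≤ cutDist σ g a u + 1 := by
  obtain ⟨hne, e, rfl | rfl⟩ := (adj_iff hΓ).1 huv
  · have := h.cutDist_apply hne.symm a
    by_cases hb : Beyond σ g e u a
    · have := this.1 hb; omega
    · have := this.2 hb; omega
  · have := h.cutDist_apply hne a
    by_cases hb : Beyond σ g e v a
    · have := this.1 hb; omega
    · have := this.2 hb; omega

theorem cutDist_le_length (h : IsGateSystem σ g) (hΓ : ∀ e u, Γ.ends (e, u) = s(u, σ e u))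
    {u v : X} (p : Γ.simplify.Walk u v) : cutDist σ g v u ≤ p.length := by
  induction p with
  | nil => simp [cutDist_self]
  | @cons u w v huw p ih =>
    have := h.cutDist_le_of_adj hΓ huw.symm v
    rw [SimpleGraph.Walk.length_cons]
    omega

/-- A path from `b` to `a` leaves `b` along some orbit and never returns, so the gate of `a` in this
orbit is not `b`. One of the two steps along the orbit therefore approaches `a`. -/
theorem exists_adj_cutDist (h : IsGateSystem σ g) (hΓ : ∀ e u, Γ.ends (e, u) = s(u, σ e u))
    (hconn : Γ.Connected) {a b : X} (hab : b ≠ a) :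
    ∃ c, Γ.simplify.Adj b c ∧ cutDist σ g a c + 1 = cutDist σ g a b := by
  obtain ⟨p, hp⟩ := hconn.exists_isPath b a
  cases p with
  | nil => exact absurd rfl hab
  | @cons _ c _ hbc p =>
    have hbp := ((SimpleGraph.Walk.cons_isPath_iff _ _).1 hp).2
    obtain ⟨hne, f, hf⟩ := (adj_iff hΓ).1 hbc
    have hsame : (σ f).SameCycle b c := by
      rcases hf with rfl | rfl
      · exact sameCycle_apply_right.2 (SameCycle.refl _ _)
      · exact sameCycle_apply_left.2 (SameCycle.refl _ _)
    have hga := h.gate_ne_of_walk hΓ f b p hbp (by rw [h.gate_of_sameCycle hsame]; exact hne.symm)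
    have hfb : σ f b ≠ b := by
      rcases hf with hf | hf
      · rw [hf]; exact hne.symm
      · intro hb; exact hne ((σ f).injective (hb.trans hf.symm))
    by_cases hbey : Beyond σ g f b a
    · exact ⟨σ f b, (adj_iff hΓ).2 ⟨hfb.symm, f, Or.inl rfl⟩, (h.cutDist_apply hfb a).1 hbey⟩
    · obtain ⟨d, rfl⟩ := (σ f).surjective b
      have hd : σ f d ≠ d := fun hd => hfb (congrArg (σ f) hd)
      refine ⟨d, (adj_iff hΓ).2 ⟨hd, f, Or.inr rfl⟩, ?_⟩
      -- If `a` were beyond the arrow from `d` to `b` but not beyond the next one, its gate would be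
      -- `b` itself.
      refine ((h.cutDist_apply hd a).2 fun hda => hga ?_).symm
      obtain ⟨j, h1, h2, hj⟩ := hda
      obtain ⟨i, rfl⟩ : ∃ i, j = i + 1 := ⟨j - 1, by omega⟩
      have hhalf : halfPeriod σ f (σ f d) = halfPeriod σ f d := by
        rw [halfPeriod, halfPeriod, ← minimalPeriod_iterate σ f d 1, iterate_one]
      rw [iterate_succ_apply, ← h.gate_apply] at hj
      rw [h.beyond_iff hfb (j := i) (by have := h.two_mul_halfPeriod hfb; omega) hj, hhalf] at hbey
      obtain rfl : i = 0 := by omega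
      exact hj

/-- Greedy descent gives a walk of length `cutDist`; conversely `cutDist` changes by at most one
along an edge. -/
theorem dist_eq_cutDist (h : IsGateSystem σ g) (hΓ : ∀ e u, Γ.ends (e, u) = s(u, σ e u))
    (hconn : Γ.Connected) (a b : X) : Γ.dist a b = cutDist σ g a b := by
  rw [Multigraph.dist, SimpleGraph.dist_comm]
  apply le_antisymm
  · induction hk : cutDist σ g a b generalizing b with
    | zero =>
      by_cases hab : b = a
      · simp [hab]
      · obtain ⟨c, -, hc⟩ := h.exists_adj_cutDist hΓ hconn hab
        omega
    | succ k ih =>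
      have hab : b ≠ a := by rintro rfl; simp [cutDist_self] at hk
      obtain ⟨c, hbc, hc⟩ := h.exists_adj_cutDist hΓ hconn hab
      have := ih c (by omega)
      have := hconn.dist_triangle (u := b) (v := c) (w := a)
      have : Γ.simplify.dist b c = 1 := SimpleGraph.dist_eq_one_iff_adj.2 hbc
      omega
  · obtain ⟨p, hp⟩ := hconn.exists_walk_length_eq_dist b a
    exact hp ▸ h.cutDist_le_length hΓ p

theorem numCloser_mul_numCloser (h : IsGateSystem σ g) (hΓ : ∀ e u, Γ.ends (e, u) = s(u, σ e u))
    (hconn : Γ.Connected) (e : E) (u : X) :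
    Γ.numCloser u (σ e u) * Γ.numCloser (σ e u) u =
      (Finset.univ.filter fun a => ¬Beyond σ g e u a).card *
        (Finset.univ.filter fun a => Beyond σ g e u a).card := by
  by_cases hu : σ e u = u
  · simp [hu, Multigraph.numCloser, not_beyond_of_fixed hu]
  · have hd := h.cutDist_apply hu
    simp only [Multigraph.numCloser, h.dist_eq_cutDist hΓ hconn]
    congr 2 <;> ext a <;> simp only [Finset.mem_filter, Finset.mem_univ, true_and] <;>
      have hda := hd a <;> by_cases hb : Beyond σ g e u a <;> grind

theorem szeged_eq_sum_totalDist (h : IsGateSystem σ g)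
    (hΓ : ∀ e u, Γ.ends (e, u) = s(u, σ e u)) (hconn : Γ.Connected) :
    Γ.szeged = ∑ v, Γ.totalDist v := by
  have hcut (a b : X) : cutDist σ g a b =
      ∑ p : E × X, (if ¬Beyond σ g p.1 p.2 a then 1 else 0) *
        (if Beyond σ g p.1 p.2 b then 1 else 0) := by
    simp only [cutDist, ite_mul, one_mul, zero_mul, ← ite_and,
      ← Finset.card_filter]
    congr 1
    ext p
    simp [mem_cuts, and_comm]
  simp only [Multigraph.totalDist, h.dist_eq_cutDist hΓ hconn, hcut]
  -- Bring the sum over arrows outermost; each inner double sum is then a product of two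
  -- cardinalities.
  rw [Finset.sum_congr rfl fun b _ => Finset.sum_comm, Finset.sum_comm, Multigraph.szeged]
  refine Finset.sum_congr rfl fun ⟨e, u⟩ _ => ?_
  rw [hΓ, Sym2.lift_mk]
  refine (h.numCloser_mul_numCloser hΓ hconn e u).trans ?_
  rw [Finset.card_filter, Finset.card_filter, Finset.sum_mul_sum, Finset.sum_comm]

end Cuts

end IsGateSystem

/-! ### Sides of tree edges and gates of the tree automaton. -/

namespace SimpleGraph.EdgeOrientation

section Side

variable {V : Type*} {G : SimpleGraph V} (o : G.EdgeOrientation)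

theorem adj_source_target (e : G.edgeSet) : G.Adj (o.source e) (o.target e) := by
  have := e.2
  rwa [← o.ends_eq e] at this

theorem source_ne_target (e : G.edgeSet) : o.source e ≠ o.target e :=
  (o.adj_source_target e).ne

open Classical in
/-- The end of the edge `e` on whose side `z` lies. -/
noncomputable def side (e : G.edgeSet) (z : V) : V :=
  if (G.deleteEdges {(e : Sym2 V)}).Reachable (o.source e) z then o.source e else o.target e

theorem side_mem (e : G.edgeSet) (z : V) : o.side e z = o.source e ∨ o.side e z = o.target e := by
  unfold side; split_ifs <;> simp

theorem side_source (e : G.edgeSet) : o.side e (o.source e) = o.source e :=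
  if_pos (Reachable.refl _)

theorem side_target (hG : G.IsAcyclic) (e : G.edgeSet) : o.side e (o.target e) = o.target e := by
  refine if_neg ?_
  have := isAcyclic_iff_forall_isBridge.1 hG e.2
  rwa [← o.ends_eq e, isBridge_iff, o.ends_eq e] at this

/-- The edge `f` survives the deletion of `e` and joins its own ends. -/
theorem side_source_eq_side_target {e f : G.edgeSet} (hef : e ≠ f) :
    o.side e (o.source f) = o.side e (o.target f) := by
  have hadj : (G.deleteEdges {(e : Sym2 V)}).Adj (o.source f) (o.target f) := by
    rw [deleteEdges_adj]
    refine ⟨o.adj_source_target f, ?_⟩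
    rw [o.ends_eq f, Set.mem_singleton_iff]
    exact fun h => hef (Subtype.ext h.symm)
  have : (G.deleteEdges {(e : Sym2 V)}).Reachable (o.source e) (o.source f) ↔
      (G.deleteEdges {(e : Sym2 V)}).Reachable (o.source e) (o.target f) :=
    ⟨fun h => h.trans hadj.reachable, fun h => h.trans hadj.symm.reachable⟩
  unfold side
  split_ifs <;> first | rfl | tauto

end Side

/-- The first letter of a word, with a default value for the empty word. -/
def firstD {V : Type*} {n : ℕ} (w : Fin n → V) (d : V) : V := if h : 0 < n then w ⟨0, h⟩ else d

theorem firstD_cons {V : Type*} {n : ℕ} (c : V) (w : Fin n → V) (d : V) :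
    firstD (Fin.cons c w : Fin (n + 1) → V) d = c := rfl

/-- The default is read only on the empty word, where distinct words do not exist. -/
theorem firstD_eq_of_ne {V : Type*} {n : ℕ} {w w' : Fin n → V} (h : w ≠ w') (d d' : V) :
    firstD w d = firstD w d' := by
  cases n with
  | zero => exact absurd (Subsingleton.elim w w') h
  | succ n => rfl

variable {V : Type*} [DecidableEq V] {G : SimpleGraph V} (o : G.EdgeOrientation)

theorem act_none {n : ℕ} (w : Fin n → V) : o.automaton.act none w = w := by
  induction n with
  | zero => rfl
  | succ n ih => exact (congrArg _ (ih _)).trans (Fin.cons_self_tail w)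

theorem act_source (e : G.edgeSet) {n : ℕ} (w : Fin n → V) :
    o.automaton.act (some e) (Fin.cons (o.source e) w : Fin (n + 1) → V) =
      Fin.cons (o.target e) (o.automaton.act (some e) w) := by
  simp [Transducer.act, automaton]

theorem act_target (e : G.edgeSet) {n : ℕ} (w : Fin n → V) :
    o.automaton.act (some e) (Fin.cons (o.target e) w : Fin (n + 1) → V) =
      Fin.cons (o.source e) w := by
  have := act_none o w
  simp only [automaton] at this
  simp [Transducer.act, automaton, (o.source_ne_target e).symm, this]

theorem act_of_ne {e : G.edgeSet} {z : V} (hx : z ≠ o.source e) (hy : z ≠ o.target e) {n : ℕ}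
    (w : Fin n → V) :
    o.automaton.act (some e) (Fin.cons z w : Fin (n + 1) → V) = Fin.cons z w := by
  have := act_none o w
  simp only [automaton] at this
  simp [Transducer.act, automaton, hx, hy, this]

theorem act_surjective (q : Option G.edgeSet) (n : ℕ) :
    Surjective (o.automaton.act q : (Fin n → V) → Fin n → V) := by
  cases q with
  | none => exact fun u => ⟨u, o.act_none u⟩
  | some e =>
    induction n with
    | zero => exact fun u => ⟨u, rfl⟩
    | succ n ih =>
      intro u
      induction u using Fin.consCases with | _ c u => ?_
      by_cases hx : c = o.source e
      · exact ⟨_, hx ▸ o.act_target e u⟩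
      by_cases hy : c = o.target e
      · obtain ⟨v, rfl⟩ := ih u
        exact ⟨_, hy ▸ o.act_source e v⟩
      exact ⟨_, o.act_of_ne hx hy u⟩

/-- The permutation of the words of length `n` given by a state of the automaton. -/
noncomputable def perm [Finite V] (n : ℕ) (q : Option G.edgeSet) : Equiv.Perm (Fin n → V) :=
  Equiv.ofBijective (o.automaton.act q) (Finite.surjective_iff_bijective.1 (o.act_surjective q n))

theorem perm_apply [Finite V] {n : ℕ} (q : Option G.edgeSet) (w : Fin n → V) :
    o.perm n q w = o.automaton.act q w := rfl

/-- The projection of the word `a` to the orbit of the word `u` under the state `e`. -/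
noncomputable def gate (e : G.edgeSet) : {n : ℕ} → (Fin n → V) → (Fin n → V) → (Fin n → V)
  | 0, u, _ => u
  | _ + 1, u, a =>
    if u 0 = o.source e ∨ u 0 = o.target e then
      Fin.cons
        (o.side e (if gate e (Fin.tail u) (Fin.tail a) = Fin.tail a then a 0
          else firstD (gate e (Fin.tail u) (Fin.tail a)) (a 0)))
        (gate e (Fin.tail u) (Fin.tail a))
    else u

/-- Each tail carries a copy of the tree. If the tail `a` lies in the smaller orbit, the side of `d`
in its copy decides. Otherwise the orbit is entered at the copy of the gate through another state
moving that gate, hence on the side of the gate's first letter. -/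
theorem gate_cons {e : G.edgeSet} {c : V} (hc : c = o.source e ∨ c = o.target e) {n : ℕ}
    (u : Fin n → V) (d : V) (a : Fin n → V) :
    o.gate e (Fin.cons c u : Fin (n + 1) → V) (Fin.cons d a : Fin (n + 1) → V) =
      Fin.cons (o.side e (if o.gate e u a = a then d else firstD (o.gate e u a) d))
        (o.gate e u a) := by
  rw [gate]
  simp [hc]

theorem gate_cons_of_not {e : G.edgeSet} {c : V} (hc : ¬(c = o.source e ∨ c = o.target e)) {n : ℕ}
    (u : Fin n → V) (a : Fin (n + 1) → V) :
    o.gate e (Fin.cons c u : Fin (n + 1) → V) a = Fin.cons c u := by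
  rw [gate]
  simp [hc]

theorem gate_act (e : G.edgeSet) {n : ℕ} (u a : Fin n → V) :
    o.gate e (o.automaton.act (some e) u) a = o.gate e u a := by
  induction n with
  | zero => rfl
  | succ n ih =>
    induction u using Fin.consCases with | _ c u => ?_
    induction a using Fin.consCases with | _ d a => ?_
    by_cases hx : c = o.source e
    · subst hx
      rw [act_source, gate_cons o (Or.inr rfl), gate_cons o (Or.inl rfl), ih]
    by_cases hy : c = o.target e
    · subst hy
      rw [act_target, gate_cons o (Or.inr rfl), gate_cons o (Or.inl rfl)]
    rw [o.act_of_ne hx hy]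

theorem gate_self (hG : G.IsAcyclic) (e : G.edgeSet) {n : ℕ} (u : Fin n → V) :
    o.gate e u u = u := by
  induction n with
  | zero => rfl
  | succ n ih =>
    induction u using Fin.consCases with | _ c u => ?_
    by_cases hc : c = o.source e ∨ c = o.target e
    · rw [gate_cons o hc, ih, if_pos rfl]
      rcases hc with rfl | rfl
      · rw [side_source]
      · rw [o.side_target hG]
    · rw [gate_cons_of_not o hc]

/-- A state `f ≠ e` changes only words whose first letter is, before and after, on the side of `e`
on which `f` lies. -/
theorem side_firstD {e f : G.edgeSet} (hef : e ≠ f) {n : ℕ} {w : Fin n → V}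
    (hw : o.automaton.act (some f) w ≠ w) (d : V) :
    o.side e (firstD w d) = o.side e (o.source f) ∧
      o.side e (firstD (o.automaton.act (some f) w) d) = o.side e (o.source f) := by
  cases n with
  | zero => exact absurd rfl hw
  | succ n =>
    induction w using Fin.consCases with | _ c w => ?_
    have hs := o.side_source_eq_side_target hef
    by_cases hx : c = o.source f
    · subst hx
      simp only [act_source, firstD_cons, hs, and_self]
    by_cases hy : c = o.target f
    · subst hy
      simp only [act_target, firstD_cons, hs, and_self]
    exact absurd (o.act_of_ne hx hy w) hw

theorem gate_act_of_ne {e f : G.edgeSet} (hef : e ≠ f) {n : ℕ} (u b : Fin n → V) :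
    o.gate e u (o.automaton.act (some f) b) = o.gate e u b := by
  induction n with
  | zero => rfl
  | succ n ih =>
    induction u using Fin.consCases with | _ c u => ?_
    induction b using Fin.consCases with | _ d b => ?_
    by_cases hc : c = o.source e ∨ c = o.target e
    swap
    · rw [gate_cons_of_not o hc, gate_cons_of_not o hc]
    have hs := o.side_source_eq_side_target hef
    by_cases hx : d = o.source f
    · subst hx
      rw [act_source, gate_cons o hc, gate_cons o hc, ih]
      congr 1
      by_cases hb : o.automaton.act (some f) b = b
      · rw [hb]
        by_cases hg : o.gate e u b = b
        · rw [if_pos hg, if_pos hg, hs]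
        · rw [if_neg hg, if_neg hg]
          rw [firstD_eq_of_ne hg]
      · have h1 := o.side_firstD hef hb
        by_cases hg : o.gate e u b = b
        -- The tail leaves the orbit at `b`: the side is read off `o.source f` before and off the
        -- first letter of `b` after, and both lie where `f` does.
        · rw [if_pos hg, if_neg (by rw [hg]; exact Ne.symm hb), hg, (h1 _).1]
        · rw [if_neg hg]
          by_cases hg' : o.gate e u b = o.automaton.act (some f) b
          · rw [if_pos hg', hg', (h1 _).2, hs]
          · rw [if_neg hg']
            rw [firstD_eq_of_ne hg]
    by_cases hy : d = o.target f
    · subst hy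
      rw [act_target, gate_cons o hc, gate_cons o hc]
      congr 1
      by_cases hg : o.gate e u b = b
      · rw [if_pos hg, if_pos hg, hs]
      · rw [if_neg hg, if_neg hg]
        rw [firstD_eq_of_ne hg]
    rw [o.act_of_ne hx hy]

/-! ### Connectedness of the Schreier graphs. -/

/-- For a fixed tail, arrows out of target letters trace a copy of `G`, so the first letter is free.
Moving it to the source of `e` lets `e` act on the tail. -/
theorem schreierGraph_reachable (hG : G.Connected) (n : ℕ) (u v : Fin n → V) :
    (o.automaton.schreierGraph n).simplify.Reachable u v := by
  have step {n : ℕ} (q : Option G.edgeSet) (u : Fin n → V) :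
      (o.automaton.schreierGraph n).simplify.Reachable u (o.automaton.act q u) := by
    by_cases hu : u = o.automaton.act q u
    · rw [← hu]
    · exact SimpleGraph.Adj.reachable ⟨hu, (q, u), rfl⟩
  induction n with
  | zero => rw [Subsingleton.elim u v]
  | succ n ih =>
    have first (a b : V) (w : Fin n → V) : (o.automaton.schreierGraph (n + 1)).simplify.Reachable
        (Fin.cons a w) (Fin.cons b w) := by
      obtain ⟨p⟩ := hG.preconnected a b
      induction p with
      | nil => rfl
      | @cons a c b hac p ihp =>
        refine Reachable.trans ?_ ihp
        have he := o.ends_eq ⟨s(a, c), hac⟩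
        have hst := step (some ⟨s(a, c), hac⟩) (Fin.cons (o.target ⟨s(a, c), hac⟩) w)
        rw [act_target] at hst
        rcases Sym2.eq_iff.1 he with ⟨h1, h2⟩ | ⟨h1, h2⟩ <;> rw [h1, h2] at hst
        · exact hst.symm
        · exact hst
    have rest (a b : V) {w w' : Fin n → V}
        (h : (o.automaton.schreierGraph n).simplify.Reachable w w') :
        (o.automaton.schreierGraph (n + 1)).simplify.Reachable (Fin.cons a w) (Fin.cons b w') := by
      have act (q : Option G.edgeSet) (a b : V) (w : Fin n → V) :
          (o.automaton.schreierGraph (n + 1)).simplify.Reachable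
            (Fin.cons a w) (Fin.cons b (o.automaton.act q w)) := by
        cases q with
        | none => rw [act_none]; exact first a b w
        | some e =>
          have hst := step (some e) (Fin.cons (o.source e) w)
          rw [act_source] at hst
          exact ((first _ _ _).trans hst).trans (first _ _ _)
      obtain ⟨p⟩ := h
      induction p generalizing a with
      | nil => exact first a b _
      | @cons w x w' hwx p ihp =>
        refine Reachable.trans ?_ (ihp b)
        obtain ⟨-, ⟨q, z⟩, hz⟩ := hwx
        rcases Sym2.eq_iff.1 hz with ⟨rfl, rfl⟩ | ⟨rfl, rfl⟩
        · exact act q a b _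
        · exact (act q b a _).symm
    induction u using Fin.consCases with | _ a u => ?_
    induction v using Fin.consCases with | _ b v => ?_
    exact rest a b (ih u v)

theorem schreierGraph_connected (hG : G.Connected) (n : ℕ) :
    (o.automaton.schreierGraph n).Connected := by
  have := hG.nonempty
  have : Nonempty (Fin n → V) := inferInstance
  exact ⟨fun u v => o.schreierGraph_reachable hG n u v⟩

/-! ### Orbits of the states and verification of the gate axioms. -/

section Finite

variable [Finite V]

/-- Of two consecutive steps exactly one starts at the source letter, and only that one passes `e`
on to the tail. -/
theorem perm_perm_cons {e : G.edgeSet} {c : V} (hc : c = o.source e ∨ c = o.target e) {n : ℕ}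
    (w : Fin n → V) :
    o.perm (n + 1) (some e) (o.perm (n + 1) (some e) (Fin.cons c w)) =
      Fin.cons c (o.perm n (some e) w) := by
  rcases hc with rfl | rfl <;> simp only [perm_apply, act_source, act_target]

theorem iterate_perm_cons {e : G.edgeSet} {c : V} (hc : c = o.source e ∨ c = o.target e) {n : ℕ}
    (w : Fin n → V) (i : ℕ) :
    (o.perm (n + 1) (some e))^[2 * i] (Fin.cons c w) =
      Fin.cons c ((o.perm n (some e))^[i] w) := by
  induction i with
  | zero => rfl
  | succ i ih =>
    rw [show 2 * (i + 1) = 2 * i + 1 + 1 by ring, iterate_succ_apply', iterate_succ_apply', ih,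
      perm_perm_cons o hc, iterate_succ_apply']

theorem sameCycle_cons {e : G.edgeSet} {c d : V} (hc : c = o.source e ∨ c = o.target e)
    (hd : d = o.source e ∨ d = o.target e) {n : ℕ} {u w : Fin n → V}
    (h : (o.perm n (some e)).SameCycle u w) :
    (o.perm (n + 1) (some e)).SameCycle (Fin.cons c u) (Fin.cons d w) := by
  have hst (w : Fin n → V) : (o.perm (n + 1) (some e)).SameCycle
      (Fin.cons (o.target e) w) (Fin.cons (o.source e) w) :=
    ⟨1, by rw [zpow_one, perm_apply, act_target]⟩
  have hcw : (o.perm (n + 1) (some e)).SameCycle (Fin.cons c u) (Fin.cons c w) := by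
    obtain ⟨j, -, rfl⟩ := IsGateSystem.exists_iterate_eq (σ := o.perm n) h
    rw [← iterate_perm_cons o hc]
    exact IsGateSystem.sameCycle_iterate (σ := o.perm (n + 1)) _ _ _
  refine hcw.trans ?_
  rcases hc with rfl | rfl <;> rcases hd with rfl | rfl
  · exact SameCycle.refl _ _
  · exact (hst w).symm
  · exact hst w
  · exact SameCycle.refl _ _

theorem sameCycle_gate (e : G.edgeSet) {n : ℕ} (u a : Fin n → V) :
    (o.perm n (some e)).SameCycle u (o.gate e u a) := by
  induction n with
  | zero => exact SameCycle.refl _ _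
  | succ n ih =>
    induction u using Fin.consCases with | _ c u => ?_
    induction a using Fin.consCases with | _ d a => ?_
    by_cases hc : c = o.source e ∨ c = o.target e
    · rw [gate_cons o hc]
      exact o.sameCycle_cons hc (o.side_mem e _) (ih u a)
    · rw [gate_cons_of_not o hc]

/-- Every step on a moved orbit swaps the first letter between the ends of `e`, so no odd number of
steps returns. -/
theorem even_minimalPeriod_perm (e : G.edgeSet) {n : ℕ} (u : Fin n → V)
    (hu : o.perm n (some e) u ≠ u) : Even (minimalPeriod (o.perm n (some e)) u) := by
  cases n with
  | zero => exact absurd rfl hu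
  | succ n =>
    induction u using Fin.consCases with | _ c u => ?_
    have hc : c = o.source e ∨ c = o.target e := by
      by_contra hc
      rw [not_or] at hc
      exact hu (o.act_of_ne hc.1 hc.2 u)
    rw [← Nat.not_odd_iff_even]
    rintro ⟨i, hi⟩
    have hodd : IsPeriodicPt (o.perm (n + 1) (some e)) (2 * i + 1) (Fin.cons c u) :=
      hi ▸ isPeriodicPt_minimalPeriod _ _
    have hper : o.perm (n + 1) (some e) ((o.perm (n + 1) (some e))^[2 * i] (Fin.cons c u)) =
        Fin.cons c u := (iterate_succ_apply' _ _ _).symm.trans hodd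
    rw [iterate_perm_cons o hc, perm_apply] at hper
    have hne := o.source_ne_target e
    rcases hc with rfl | rfl
    · rw [act_source] at hper
      exact hne (Fin.cons_inj.1 hper).1.symm
    · rw [act_target] at hper
      exact hne (Fin.cons_inj.1 hper).1

/-- Outside the orbit the tails are outside the smaller orbit too, so both first letters are read
off the same tail gate. -/
theorem gate_act_of_not_sameCycle {e : G.edgeSet} {n : ℕ} {u b : Fin n → V}
    (hub : ¬(o.perm n (some e)).SameCycle u b) :
    o.gate e u (o.automaton.act (some e) b) = o.gate e u b := by
  induction n with
  | zero => rfl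
  | succ n ih =>
    induction u using Fin.consCases with | _ c u => ?_
    induction b using Fin.consCases with | _ d b => ?_
    by_cases hc : c = o.source e ∨ c = o.target e
    swap
    · rw [gate_cons_of_not o hc, gate_cons_of_not o hc]
    by_cases hd : d = o.source e ∨ d = o.target e
    swap
    · rw [not_or] at hd
      rw [o.act_of_ne hd.1 hd.2]
    have hub' : ¬(o.perm n (some e)).SameCycle u b := fun h => hub (o.sameCycle_cons hc hd h)
    have hg : o.gate e u b ≠ b := fun h => hub' (by simpa only [h] using o.sameCycle_gate e u b)
    have hg' : o.gate e u b ≠ o.automaton.act (some e) b := fun h => hub' <| by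
      have := o.sameCycle_gate e u b
      rwa [h, ← perm_apply, sameCycle_apply_right] at this
    rcases hd with rfl | rfl
    · rw [act_source, gate_cons o hc, gate_cons o hc, ih hub', if_neg hg, if_neg hg']
      rw [firstD_eq_of_ne hg]
    · rw [act_target, gate_cons o hc, gate_cons o hc, if_neg hg, if_neg hg]
      rw [firstD_eq_of_ne hg]

theorem isGateSystem (hG : G.IsAcyclic) (n : ℕ) :
    IsGateSystem (o.perm n) fun q u a => q.elim u fun e => o.gate e u a where
  gate_apply q u a := by
    cases q with
    | none => exact o.act_none u
    | some e => exact o.gate_act e u a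
  sameCycle q u a := by
    cases q with
    | none => exact SameCycle.refl _ _
    | some e => exact o.sameCycle_gate e u a
  gate_self q u := by
    cases q with
    | none => rfl
    | some e => exact o.gate_self hG e u
  gate_move q r u b h := by
    cases q with
    | none => rfl
    | some e =>
      cases r with
      | none => exact congrArg (o.gate e u) (o.act_none b)
      | some f =>
        by_cases hef : e = f
        · subst hef
          exact o.gate_act_of_not_sameCycle fun hs => h ⟨rfl, hs⟩
        · exact o.gate_act_of_ne hef u b
  even_period q u hu := by
    cases q with
    | none => exact absurd (o.act_none u) hu
    | some e => exact o.even_minimalPeriod_perm e u hu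

end Finite

end SimpleGraph.EdgeOrientation

theorem mainTheorem9 {V : Type*} [Fintype V] [DecidableEq V] (G : SimpleGraph V)
    [DecidableRel G.Adj] (hG : G.IsTree) (o : G.EdgeOrientation) (n : ℕ) :
    (o.automaton.schreierGraph n).Connected ∧
      ((o.automaton.schreierGraph n).szeged : ℚ) = 2 * (o.automaton.schreierGraph n).wiener := by
  have hconn := o.schreierGraph_connected hG.connected n
  refine ⟨hconn, ?_⟩
  rw [(o.isGateSystem hG.isAcyclic n).szeged_eq_sum_totalDist (fun _ _ => rfl) hconn,
    Multigraph.wiener]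
  push_cast
  ring
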